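/- Let $G$ be a (word) hyperbolic group, i.e. a finitely generated group whose word metric with respect to some (equivalently, every) finite generating set is Gromov hyperbolic. A group is virtually cyclic if it has a cyclic subgroup of finite index; a virtually cyclic group $V$ is of type I if it admits an epimorphism onto the infinite cyclic group $\mathbb{Z}$ (so $V$ is infinite). For an infinite virtually cyclic group $V$ let $K_V$ be its largest finite normal subgroup and $Q_V = V/K_V$; if $V$ is of type I then $Q_V$ is infinite cyclic. A homomorphism $f\colon V\to V'$ between groups of type I induces a homomorphism $Q_f\colon Q_V\to Q_{V'}$. The infinite virtually cyclic subgroups of type I of $G$ are called orientable if one can choose, for every type I virtually cyclic subgroup $V\subseteq G$, a generator $\sigma_V$ of $Q_V$ such that, whenever $V,V'\subseteq G$ are virtually cyclic subgroups of type I and $f\colon V\to V'$ is an inclusion $V \subseteq V'$ or a conjugation $v\mapsto gvg^{-1}$ by some $g\in G$ with $gVg^{-1}\subseteq V'$, the map $Q_f$ sends $\sigma_V$ to a positive multiple of $\sigma_{V'}$ (i.e. to $\sigma_{V'}^{\,n}$ for some integer $n\ge 1$). Then the infinite virtually cyclic subgroups of type I of $G$ are orientable if and only if every infinite virtually cyclic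 subgroup of $G$ is of type I. -/

import Mathlib

/-- The Gromov product `(x | y)_w` in a graph, for the path metric on its vertices. -/
noncomputable def SimpleGraph.gromovProduct {X : Type*} (Γ : SimpleGraph X) (x y w : X) : ℝ :=
  ((Γ.dist x w : ℝ) + (Γ.dist y w : ℝ) - (Γ.dist x y : ℝ)) / 2

/-- A finitely generated group is (Gromov, word) hyperbolic if for some finite generating set the
word metric, which is the path metric on the vertices of the Cayley graph, is `δ`-hyperbolic for
some `δ`. -/
def IsHyperbolicGroup (G : Type*) [Group G] : Prop :=
  ∃ S : Set G, S.Finite ∧ Subgroup.closure S = ⊤ ∧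
    ∃ δ : ℝ, ∀ x y z w : G,
      min ((SimpleGraph.mulCayley S).gromovProduct x y w)
          ((SimpleGraph.mulCayley S).gromovProduct y z w) - δ ≤
        (SimpleGraph.mulCayley S).gromovProduct x z w

/-- A group is virtually cyclic if it has a cyclic subgroup of finite index. -/
def IsVirtuallyCyclic (V : Type*) [Group V] : Prop :=
  ∃ C : Subgroup V, IsCyclic C ∧ C.FiniteIndex

/-- A virtually cyclic group is of type I if it admits an epimorphism onto the infinite cyclic
group. (Such a group is automatically infinite.) -/
def IsTypeI (V : Type*) [Group V] : Prop :=
  IsVirtuallyCyclic V ∧ ∃ p : V →* Multiplicative ℤ, Function.Surjective p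

/-- The subgroup `K_V`: the supremum of all finite normal subgroups of `V`. For an infinite
virtually cyclic group this is the largest finite normal subgroup. -/
def maxFiniteNormal (V : Type*) [Group V] : Subgroup V :=
  sSup {N : Subgroup V | N.Normal ∧ Finite N}

instance maxFiniteNormal_normal (V : Type*) [Group V] : (maxFiniteNormal V).Normal :=
  Subgroup.sSup_normal _ fun _ hN => hN.1

theorem le_maxFiniteNormal {V : Type*} [Group V] {N : Subgroup V} (hN : N.Normal)
    (hfin : Finite N) : N ≤ maxFiniteNormal V :=
  le_sSup ⟨hN, hfin⟩

/-- The kernel of an epimorphism from a virtually cyclic group onto `ℤ` is finite. -/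
theorem IsVirtuallyCyclic.finite_ker {V : Type*} [Group V] (hV : IsVirtuallyCyclic V)
    (p : V →* Multiplicative ℤ) (hp : Function.Surjective p) : Finite p.ker := by
  obtain ⟨C, hC, hfi⟩ := hV
  obtain ⟨c, hc⟩ := hC.exists_generator
  have hpc : p c ≠ 1 := by
    intro h1
    have hle : C ≤ p.ker := by
      intro x hx
      obtain ⟨n, hn⟩ := Subgroup.mem_zpowers_iff.1 (hc ⟨x, hx⟩)
      have hn' : (c : V) ^ n = x := by simpa using congrArg Subtype.val hn
      rw [MonoidHom.mem_ker, ← hn', map_zpow, h1, one_zpow]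
    have : p.ker.FiniteIndex := Subgroup.finiteIndex_of_le hle
    have hfq : Finite (V ⧸ p.ker) := inferInstance
    have : Finite (Multiplicative ℤ) :=
      Finite.of_equiv _ (QuotientGroup.quotientKerEquivOfSurjective p hp).toEquiv
    exact not_finite (Multiplicative ℤ)
  have hinj : Function.Injective (fun x : p.ker => (QuotientGroup.mk (x : V) : V ⧸ C)) := by
    intro x y hxy
    have hmem : (x : V)⁻¹ * y ∈ C := QuotientGroup.eq.1 hxy
    obtain ⟨n, hn⟩ := Subgroup.mem_zpowers_iff.1 (hc ⟨_, hmem⟩)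
    have hn' : (c : V) ^ n = (x : V)⁻¹ * y := by simpa using congrArg Subtype.val hn
    have h1 : p c ^ n = 1 := by
      rw [← map_zpow, hn', map_mul, map_inv, MonoidHom.mem_ker.1 x.2, MonoidHom.mem_ker.1 y.2]
      simp
    have h2 : n * Multiplicative.toAdd (p c) = 0 := by
      simpa using congrArg Multiplicative.toAdd h1
    have h3 : n = 0 := by
      rcases mul_eq_zero.1 h2 with h | h
      · exact h
      · exact absurd (Multiplicative.toAdd.injective (by simpa using h)) hpc
    rw [h3, zpow_zero] at hn'
    exact Subtype.ext (inv_mul_eq_one.1 hn'.symm)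
  exact Finite.of_injective _ hinj

/-- Homomorphisms into a type I group map `K_V` to `K_W`. -/
theorem maxFiniteNormal_le_comap {V W : Type*} [Group V] [Group W] (hW : IsTypeI W)
    (f : V →* W) : maxFiniteNormal V ≤ (maxFiniteNormal W).comap f := by
  obtain ⟨hvc, p, hp⟩ := hW
  refine sSup_le fun N hN x hx => ?_
  have := hN.2
  refine le_maxFiniteNormal (N := p.ker) inferInstance (hvc.finite_ker p hp) ?_
  have hfo : IsOfFinOrder x :=
    N.subtype.isOfFinOrder (isOfFinOrder_of_finite (⟨x, hx⟩ : N))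
  obtain ⟨n, hn, hxn⟩ := isOfFinOrder_iff_pow_eq_one.1 hfo
  have h1 : p (f x) ^ n = 1 := by rw [← map_pow, ← map_pow, hxn, map_one, map_one]
  have h2 : (n : ℤ) * Multiplicative.toAdd (p (f x)) = 0 := by
    simpa using congrArg Multiplicative.toAdd h1
  have h3 : Multiplicative.toAdd (p (f x)) = 0 := by
    rcases mul_eq_zero.1 h2 with h | h
    · omega
    · exact h
  exact Multiplicative.toAdd.injective (by simpa using h3)

/-- The quotient `Q_V = V / K_V`; it is infinite cyclic if `V` is of type I. -/
abbrev QuotMaxFiniteNormal (V : Type*) [Group V] : Type _ :=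
  V ⧸ maxFiniteNormal V

/-- The homomorphism `Q_f : Q_V → Q_W` induced by a homomorphism `f : V → W`. -/
def quotMaxFiniteNormalMap {V W : Type*} [Group V] [Group W] (hW : IsTypeI W) (f : V →* W) :
    QuotMaxFiniteNormal V →* QuotMaxFiniteNormal W :=
  QuotientGroup.map (maxFiniteNormal V) (maxFiniteNormal W) f (maxFiniteNormal_le_comap hW f)

/-- The homomorphism `f : V → W` between subgroups of `G` is an inclusion or is given by
conjugation by an element of `G`. -/
def IsInclusionOrConjugation {G : Type*} [Group G] {V W : Subgroup G} (f : V →* W) : Prop :=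
  (∀ v : V, (f v : G) = v) ∨ ∃ g : G, ∀ v : V, (f v : G) = g * v * g⁻¹

/-- An orientation: a generator `σ_V` of `Q_V` for every type I subgroup `V` of `G`, such that
every inclusion or conjugation `f : V → W` sends `σ_V` to a positive multiple of `σ_W` (written
multiplicatively). -/
def IsOrientation {G : Type*} [Group G]
    (σ : ∀ V : {V : Subgroup G // IsTypeI V}, QuotMaxFiniteNormal V.1) : Prop :=
  (∀ V, Subgroup.zpowers (σ V) = ⊤) ∧
    ∀ (V W : {V : Subgroup G // IsTypeI V}) (f : V.1 →* W.1), IsInclusionOrConjugation f →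
      ∃ n : ℕ, 0 < n ∧ quotMaxFiniteNormalMap W.2 f (σ V) = σ W ^ n

/-- The infinite virtually cyclic subgroups of type I of `G` are orientable. -/
def TypeISubgroupsOrientable (G : Type*) [Group G] : Prop :=
  ∃ σ : ∀ V : {V : Subgroup G // IsTypeI V}, QuotMaxFiniteNormal V.1, IsOrientation σ

/-! Both conditions amount to the same thing: no element of infinite order has a positive power
conjugate to a negative one. If an infinite virtually cyclic `V` is not of type I, some `v` in `V`
inverts some `d` of infinite order. Conjugation by `v` acts on `Q` of the cyclic group of `d` as
inversion, so an orientation would give `σ⁻¹ = σ ^ n` with `n > 0`, although `σ` has infinite order.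
Conversely, call elements commensurable when positive powers of them are conjugate. If no `x` of
infinite order is commensurable to `x⁻¹`, choosing one class from each pair of inverse classes
orients all type I subgroups at once (`exists_positive`). It remains to rule out `g * c ^ m * g⁻¹ =
c ^ (-n)` in a hyperbolic group. Centralizers of infinite order elements grow at most linearly
(`exists_card_centralizer_le`). If `m ≠ n`, the powers of `c` would be logarithmically distorted,
too many for linear growth; so `m = n`. Then `g ^ 2` commutes with `d = c ^ m`, and linear growth
forces a relation between them, which makes `g` torsion. So `d` and `g` generate an infinite
virtually cyclic group with no map onto `ℤ`. -/

/-- `ℓ` behaves like the word length of a `δ`-hyperbolic group: it is a proper geodesic length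
function whose left-invariant metric `(x, y) ↦ ℓ (x⁻¹ * y)` satisfies the four-point inequality. -/
structure IsHyperbolicLength {G : Type*} [Group G] (ℓ : G → ℕ) (δ : ℕ) : Prop where
  map_one : ℓ 1 = 0
  map_inv : ∀ x, ℓ x⁻¹ = ℓ x
  map_mul_le : ∀ x y, ℓ (x * y) ≤ ℓ x + ℓ y
  finite_ball : ∀ r, {x | ℓ x ≤ r}.Finite
  exists_geodesic : ∀ w t, t ≤ ℓ w → ∃ y, ℓ y = t ∧ t + ℓ (y⁻¹ * w) = ℓ w
  four_point : ∀ x y z w, ℓ (x⁻¹ * z) + ℓ (y⁻¹ * w) ≤ ℓ (x⁻¹ * y) + ℓ (z⁻¹ * w) + 2 * δ ∨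
    ℓ (x⁻¹ * z) + ℓ (y⁻¹ * w) ≤ ℓ (y⁻¹ * z) + ℓ (x⁻¹ * w) + 2 * δ

/-! ### Word length in the Cayley graph -/

section CayleyGraph

variable {G : Type*} [Group G] (S : Set G)

/-- Left multiplication as an automorphism of the Cayley graph. -/
def SimpleGraph.mulCayleyMulLeft (g : G) :
    SimpleGraph.mulCayley S ≃g SimpleGraph.mulCayley S where
  toEquiv := Equiv.mulLeft g
  map_rel_iff' := SimpleGraph.mulCayley_adj_mul_iff_right

theorem SimpleGraph.mulCayley_dist_mul_left_le (g x y : G)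
    (h : (SimpleGraph.mulCayley S).Connected) :
    (SimpleGraph.mulCayley S).dist (g * x) (g * y) ≤ (SimpleGraph.mulCayley S).dist x y := by
  obtain ⟨p, hp⟩ := h.exists_walk_length_eq_dist x y
  rw [← hp, ← SimpleGraph.Walk.length_map (SimpleGraph.mulCayleyMulLeft S g).toHom p]
  exact SimpleGraph.dist_le _

variable {S}

theorem SimpleGraph.mulCayley_dist_mul_left (h : (SimpleGraph.mulCayley S).Connected)
    (g x y : G) :
    (SimpleGraph.mulCayley S).dist (g * x) (g * y) = (SimpleGraph.mulCayley S).dist x y := by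
  refine le_antisymm (mulCayley_dist_mul_left_le S g x y h) ?_
  simpa using mulCayley_dist_mul_left_le S g⁻¹ (g * x) (g * y) h

theorem SimpleGraph.mulCayley_reachable_mul (x : G) {s : G} (hs : s ∈ S) :
    (SimpleGraph.mulCayley S).Reachable x (x * s) := by
  by_cases h : x = x * s
  · rw [← h]
  · exact SimpleGraph.Adj.reachable ((mulCayley_adj S _ _).2 ⟨h, Or.inl (by simpa using hs)⟩)

theorem SimpleGraph.mulCayley_connected (hS : Subgroup.closure S = ⊤) :
    (SimpleGraph.mulCayley S).Connected := by
  have key : ∀ g ∈ Subgroup.closure S, (SimpleGraph.mulCayley S).Reachable 1 g := by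
    intro g hg
    induction hg using Subgroup.closure_induction_right with
    | one => exact SimpleGraph.Reachable.refl _
    | mul_right x _ s hs ih => exact ih.trans (mulCayley_reachable_mul x hs)
    | mul_inv_cancel x _ s hs ih =>
      exact ih.trans (by simpa using (mulCayley_reachable_mul (x * s⁻¹) hs).symm)
  have key' : ∀ g, (SimpleGraph.mulCayley S).Reachable 1 g := fun g =>
    key g (hS ▸ Subgroup.mem_top g)
  exact (SimpleGraph.connected_iff _).2 ⟨fun x y => (key' x).symm.trans (key' y), ⟨1⟩⟩

theorem SimpleGraph.Connected.exists_dist_eq {V : Type*} {Γ : SimpleGraph V} (h : Γ.Connected)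
    (u v : V) {t : ℕ} (ht : t ≤ Γ.dist u v) :
    ∃ y, Γ.dist u y = t ∧ t + Γ.dist y v = Γ.dist u v := by
  obtain ⟨p, hp⟩ := h.exists_walk_length_eq_dist u v
  have h1 : Γ.dist u (p.getVert t) ≤ t := by
    have := SimpleGraph.dist_le (p.take t)
    rw [SimpleGraph.Walk.take_length] at this
    omega
  have h2 : Γ.dist (p.getVert t) v ≤ p.length - t := by
    have := SimpleGraph.dist_le (p.drop t)
    rwa [SimpleGraph.Walk.drop_length] at this
  have h3 := h.dist_triangle (u := u) (v := p.getVert t) (w := v)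
  exact ⟨p.getVert t, by omega, by omega⟩

theorem SimpleGraph.mulCayley_finite_ball (hfin : S.Finite)
    (h : (SimpleGraph.mulCayley S).Connected) (r : ℕ) :
    {x | (SimpleGraph.mulCayley S).dist 1 x ≤ r}.Finite := by
  induction r with
  | zero =>
    refine (Set.finite_singleton (1 : G)).subset fun x hx => ?_
    exact ((h.dist_eq_zero_iff).1 (Nat.le_zero.1 hx)).symm
  | succ r ih =>
    refine (ih.union (ih.mul (hfin.union hfin.inv))).subset fun x hx => ?_
    by_cases hxr : (SimpleGraph.mulCayley S).dist 1 x ≤ r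
    · exact Or.inl hxr
    right
    have hx' : (SimpleGraph.mulCayley S).dist 1 x ≤ r + 1 := hx
    obtain ⟨y, hy1, hy2⟩ := h.exists_dist_eq 1 x (t := r) (by omega)
    have hadj : (SimpleGraph.mulCayley S).dist y x = 1 := by omega
    rw [SimpleGraph.dist_eq_one_iff_adj, mulCayley_adj] at hadj
    refine Set.mem_mul.2 ⟨y, hy1.le, y⁻¹ * x, ?_, by simp⟩
    rcases hadj.2 with h' | h'
    · exact Or.inl h'
    · exact Or.inr (by simpa using h')

theorem IsHyperbolicGroup.exists_isHyperbolicLength (hG : IsHyperbolicGroup G) :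
    ∃ (ℓ : G → ℕ) (δ : ℕ), IsHyperbolicLength ℓ δ := by
  obtain ⟨S, hfin, hS, δ, hδ⟩ := hG
  have hc := SimpleGraph.mulCayley_connected hS
  have hd : ∀ x y : G, (SimpleGraph.mulCayley S).dist 1 (x⁻¹ * y) =
      (SimpleGraph.mulCayley S).dist x y := fun x y => by
    simpa using (SimpleGraph.mulCayley_dist_mul_left hc x 1 (x⁻¹ * y)).symm
  obtain ⟨D, hD⟩ := exists_nat_ge δ
  refine ⟨fun x => (SimpleGraph.mulCayley S).dist 1 x, D, by simp, fun x => ?_, fun x y => ?_,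
    SimpleGraph.mulCayley_finite_ball hfin hc, fun w t ht => ?_, fun x y z w => ?_⟩
  · have := hd x 1
    rw [mul_one] at this
    rw [this, SimpleGraph.dist_comm]
  · have h1 := hc.dist_triangle (u := (1 : G)) (v := x) (w := x * y)
    rw [← hd x (x * y), inv_mul_cancel_left] at h1
    exact h1
  · simpa only [hd] using hc.exists_dist_eq 1 w ht
  · simp only [hd]
    have := hδ x y z w
    simp only [SimpleGraph.gromovProduct] at this
    rw [sub_le_iff_le_add, min_le_iff] at this
    rcases this with h | h
    · left
      have h' : ((SimpleGraph.mulCayley S).dist x z : ℝ) + (SimpleGraph.mulCayley S).dist y w ≤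
        (SimpleGraph.mulCayley S).dist x y + (SimpleGraph.mulCayley S).dist z w + 2 * D := by
        linarith
      exact_mod_cast h'
    · right
      have h' : ((SimpleGraph.mulCayley S).dist x z : ℝ) + (SimpleGraph.mulCayley S).dist y w ≤
        (SimpleGraph.mulCayley S).dist y z + (SimpleGraph.mulCayley S).dist x w + 2 * D := by
        linarith
      exact_mod_cast h'

end CayleyGraph

/-! ### Linear growth of centralizers -/

namespace IsHyperbolicLength

variable {G : Type*} [Group G] {ℓ : G → ℕ} {δ : ℕ}

theorem map_pow_le (hℓ : IsHyperbolicLength ℓ δ) (x : G) (n : ℕ) : ℓ (x ^ n) ≤ n * ℓ x := by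
  induction n with
  | zero => simp [hℓ.map_one]
  | succ n ih =>
    rw [pow_succ, Nat.succ_mul]
    exact (hℓ.map_mul_le _ _).trans (by omega)

theorem dist_comm (hℓ : IsHyperbolicLength ℓ δ) (x y : G) : ℓ (x⁻¹ * y) = ℓ (y⁻¹ * x) := by
  rw [← hℓ.map_inv, mul_inv_rev, inv_inv]

theorem exists_pow_length_gt (hℓ : IsHyperbolicLength ℓ δ) {c : G} (hc : ¬IsOfFinOrder c)
    (r : ℕ) : ∃ n : ℕ, r < ℓ (c ^ n) := by
  by_contra! h
  exact Set.infinite_of_injective_forall_mem (injective_pow_iff_not_isOfFinOrder.2 hc) h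
    (hℓ.finite_ball r)

/-- An isometry moving both endpoints of a geodesic by at most `r` moves points far from the
endpoints along the geodesic, up to a bounded error. -/
theorem exists_near_geodesic (hℓ : IsHyperbolicLength ℓ δ) {w z : G} {r h : ℕ} {y : ℕ → G}
    (hy : ∀ t ≤ ℓ w, ℓ (y t) = t ∧ t + ℓ ((y t)⁻¹ * w) = ℓ w) (hz : ℓ z ≤ r)
    (hzw : ℓ (w⁻¹ * (z * w)) ≤ r) (hr : r + 2 * δ < h) (hw : h + r + 2 * δ < ℓ w) :
    ∃ t ≤ h + r, ℓ ((y t)⁻¹ * (z * y h)) ≤ 6 * δ := by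
  obtain ⟨hyh, hyh'⟩ := hy h (by omega)
  have e1 : z⁻¹ * (z * y h) = y h := by group
  have e2 : (z * w)⁻¹ * (z * y h) = w⁻¹ * y h := by group
  have e3 : z⁻¹ * (z * w) = w := by group
  have hp : ℓ (z * y h) ≤ h + r := (hℓ.map_mul_le _ _).trans (by omega)
  obtain ⟨ht, ht'⟩ := hy (ℓ (z * y h)) (by omega)
  -- With `p = z * y h`, `f1` and `f2` give `d(1, p) + d(p, w) ≤ d(1, w) + 4δ`; the bounds on `h`
  -- exclude their other alternatives. `f3` compares `p` with the geodesic point at the same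
  -- distance from `1` and costs another `2δ`.
  have f1 := hℓ.four_point z 1 (z * w) (z * y h)
  have f2 := hℓ.four_point 1 w (z * w) (z * y h)
  have f3 := hℓ.four_point 1 (z * y h) w (y (ℓ (z * y h)))
  have tri := hℓ.map_mul_le z⁻¹ (z * y h)
  have tri' := hℓ.map_mul_le (w⁻¹ * (z * w)) ((z * w)⁻¹ * (z * y h))
  have tri'' := hℓ.map_mul_le ((w⁻¹ * (z * w))⁻¹) (w⁻¹ * (z * y h))
  have e4 : (w⁻¹ * (z * w))⁻¹ * (w⁻¹ * (z * y h)) = (z * w)⁻¹ * (z * y h) := by group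
  rw [e4, hℓ.map_inv] at tri''
  simp only [inv_one, one_mul, mul_one, e1, e2, e3, hℓ.map_inv] at f1 f2 f3 tri tri''
  rw [hℓ.dist_comm w (y h)] at *
  rw [hℓ.dist_comm w (y (ℓ (z * y h))), hℓ.dist_comm (z * y h) w,
    hℓ.dist_comm (z * y h) (y (ℓ (z * y h)))] at f3
  exact ⟨_, hp, by omega⟩

/-- The centralizer of an element of infinite order has at most linear growth. -/
theorem exists_card_centralizer_le (hℓ : IsHyperbolicLength ℓ δ) {c : G}
    (hc : ¬IsOfFinOrder c) :
    ∃ A : ℕ, ∀ (r : ℕ) (F : Finset G), (∀ z ∈ F, Commute z c ∧ ℓ z ≤ r) →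
      F.card ≤ A * (r + 1) := by
  classical
  set B := (hℓ.finite_ball (6 * δ)).toFinset with hB
  refine ⟨(2 * δ + 2) * B.card, fun r F hF => ?_⟩
  -- `z` moves `1` and `c ^ n` by at most `r`, so it moves `y h` near some `y t`. The index `t` and
  -- the bounded error `(y t)⁻¹ * z * y h` determine `z`.
  set h := r + 2 * δ + 1 with hh
  obtain ⟨n, hn⟩ := hℓ.exists_pow_length_gt hc (h + r + 2 * δ)
  choose! y hy using fun t => hℓ.exists_geodesic (c ^ n) t
  have hex : ∀ z ∈ F, ∃ t ≤ h + r, ℓ ((y t)⁻¹ * (z * y h)) ≤ 6 * δ := fun z hz => by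
    refine hℓ.exists_near_geodesic hy (hF z hz).2 ?_ (by omega) hn
    rw [((hF z hz).1.pow_right n).eq, inv_mul_cancel_left]
    exact (hF z hz).2
  choose! t ht ht' using hex
  calc F.card ≤ (Finset.range (h + r + 1) ×ˢ B).card := by
        refine Finset.card_le_card_of_injOn (fun z => (t z, (y (t z))⁻¹ * (z * y h)))
          (fun z hz => ?_) fun z hz z' hz' hzz => ?_
        · simp only [Finset.coe_product, Set.mem_prod, Finset.coe_range, Set.mem_Iio, hB,
            Set.Finite.coe_toFinset, Set.mem_ofPred_eq]
          exact ⟨Nat.lt_succ_of_le (ht z hz), ht' z hz⟩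
        · obtain ⟨h1, h2⟩ := Prod.mk.inj hzz
          rw [h1] at h2
          simpa using h2
    _ = (h + r + 1) * B.card := by simp
    _ ≤ ((2 * δ + 2) * (r + 1)) * B.card := Nat.mul_le_mul_right _ (by
        rw [hh]; nlinarith)
    _ = _ := by ring

end IsHyperbolicLength

/-! ### Commuting elements and distortion of cyclic subgroups -/

namespace IsHyperbolicLength

variable {G : Type*} [Group G] {ℓ : G → ℕ} {δ : ℕ}

/-- Commuting elements of a hyperbolic group do not generate a free abelian group of rank two. -/
theorem exists_pow_mul_pow_eq_of_commute (hℓ : IsHyperbolicLength ℓ δ) {a c : G}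
    (hc : ¬IsOfFinOrder c) (hac : Commute a c) :
    ∃ j k j' k' : ℕ, (j, k) ≠ (j', k') ∧ a ^ j * c ^ k = a ^ j' * c ^ k' := by
  classical
  by_contra! hne
  have hinj : Function.Injective fun q : ℕ × ℕ => a ^ q.1 * c ^ q.2 := fun q q' hq => by
    by_contra h
    exact hne _ _ _ _ h hq
  obtain ⟨A, hA⟩ := hℓ.exists_card_centralizer_le hc
  have key : ∀ N : ℕ, N * N ≤ A * (N * (ℓ a + ℓ c) + 1) := fun N => by
    have := hA (N * (ℓ a + ℓ c))
      ((Finset.range N ×ˢ Finset.range N).image fun q : ℕ × ℕ => a ^ q.1 * c ^ q.2) ?_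
    · simpa [Finset.card_image_of_injective _ hinj] using this
    · intro z hz
      obtain ⟨q, hq, rfl⟩ := Finset.mem_image.1 hz
      simp only [Finset.mem_product, Finset.mem_range] at hq
      refine ⟨(hac.pow_left _).mul_left ((Commute.refl c).pow_left _), ?_⟩
      have h1 := hℓ.map_mul_le (a ^ q.1) (c ^ q.2)
      have h2 := (hℓ.map_pow_le a q.1).trans (Nat.mul_le_mul_right _ hq.1.le)
      have h3 := (hℓ.map_pow_le c q.2).trans (Nat.mul_le_mul_right _ hq.2.le)
      rw [mul_add]
      omega
  have := key (A * (ℓ a + ℓ c) + A + 1)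
  nlinarith [Nat.zero_le (A * (ℓ a + ℓ c))]

/-- If `c ^ m` is conjugate to `c ^ n` or `c ^ (-n)` with `m < n`, the cyclic group generated by
`c` is logarithmically distorted. -/
theorem pow_length_le_of_conj (hℓ : IsHyperbolicLength ℓ δ) {c g : G} {m n : ℕ}
    (hmn : m < n) (hg : ∀ q : ℕ, ℓ (c ^ (n * q)) = ℓ (g * c ^ (m * q) * g⁻¹)) (t : ℕ) :
    ∀ k : ℕ, k * m ^ t ≤ n ^ t → ℓ (c ^ k) ≤ (2 * ℓ g + n * ℓ c) * (t + 1) := by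
  -- Write `k = n * q + s` with `s < n` and trade `c ^ (n * q)` for a conjugate of `c ^ (m * q)` or
  -- its inverse. Each round shrinks the exponent by a factor `m / n` at bounded cost; `t` counts
  -- the rounds.
  have step : ∀ k : ℕ, ℓ (c ^ k) ≤ ℓ (c ^ (m * (k / n))) + (2 * ℓ g + n * ℓ c) := fun k => by
    have h1 := hℓ.map_mul_le (c ^ (n * (k / n))) (c ^ (k % n))
    rw [← pow_add, Nat.div_add_mod, hg] at h1
    have h2 := hℓ.map_mul_le (g * c ^ (m * (k / n))) g⁻¹
    have h3 := hℓ.map_mul_le g (c ^ (m * (k / n)))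
    rw [hℓ.map_inv] at h2
    have h4 := (hℓ.map_pow_le c (k % n)).trans
      (Nat.mul_le_mul_right _ (Nat.mod_lt k (by omega)).le)
    omega
  induction t with
  | zero =>
    intro k hk
    have hk' : k ≤ n := by
      simp only [pow_zero, mul_one] at hk
      omega
    have := (hℓ.map_pow_le c k).trans (Nat.mul_le_mul_right _ hk')
    omega
  | succ t ih =>
    intro k hk
    have hn : 0 < n := by omega
    have h1 : m * (k / n) * m ^ t ≤ n ^ t := by
      refine Nat.le_of_mul_le_mul_left (?_ : n * _ ≤ n * _) hn
      calc n * (m * (k / n) * m ^ t) = (n * (k / n)) * m ^ (t + 1) := by ring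
        _ ≤ k * m ^ (t + 1) := Nat.mul_le_mul_right _ (Nat.mul_div_le k n)
        _ ≤ n * n ^ t := by rw [← pow_succ']; exact hk
    have h2 := ih _ h1
    have h3 := step k
    calc _ ≤ _ := h3
      _ ≤ (2 * ℓ g + n * ℓ c) * (t + 1) + (2 * ℓ g + n * ℓ c) := by omega
      _ = _ := by ring

/-- Distortion puts about `(n / m) ^ t` powers of `c` in a ball of radius linear in `t`. They all
centralize `c`, so linear growth fails for large `t`. -/
theorem not_lt_of_conj (hℓ : IsHyperbolicLength ℓ δ) {c g : G} (hc : ¬IsOfFinOrder c) {m n : ℕ}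
    (hm : 0 < m) (hg : ∀ q : ℕ, ℓ (c ^ (n * q)) = ℓ (g * c ^ (m * q) * g⁻¹)) : ¬m < n := by
  classical
  intro hmn
  obtain ⟨A, hA⟩ := hℓ.exists_card_centralizer_le hc
  set M := 2 * ℓ g + n * ℓ c with hM
  have key : ∀ t : ℕ, n ^ t / m ^ t ≤ A * (M * (t + 1) + 1) := fun t => by
    have := hA (M * (t + 1)) ((Finset.range (n ^ t / m ^ t)).image fun k => c ^ k) ?_
    · simpa [Finset.card_image_of_injective _ (injective_pow_iff_not_isOfFinOrder.2 hc)]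
        using this
    · intro z hz
      obtain ⟨k, hk, rfl⟩ := Finset.mem_image.1 hz
      refine ⟨(Commute.refl c).pow_left _, hℓ.pow_length_le_of_conj hmn hg t k ?_⟩
      exact (Nat.le_div_iff_mul_le (by positivity)).1 (Finset.mem_range.1 hk).le
  have hm' : (0 : ℝ) < m := by exact_mod_cast hm
  have hlt : (1 : ℝ) < n / m := by rw [one_lt_div hm']; exact_mod_cast hmn
  -- For `t ≥ 1` the constant times `t` dominates `A * (M * (t + 1) + 1) + 1`.
  have hlim := (tendsto_pow_const_div_const_pow_of_one_lt 1 hlt).const_mul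
    (((A * M : ℕ) : ℝ) + (A * M + A + 1 : ℕ))
  rw [mul_zero] at hlim
  obtain ⟨t, ht, ht1⟩ := ((hlim.eventually (gt_mem_nhds one_pos)).and
    (Filter.eventually_ge_atTop 1)).exists
  have hlb : (n / m : ℝ) ^ t < n ^ t / m ^ t + 1 := by rw [div_pow]; linarith
  have h1 : (n / m : ℝ) ^ t < A * (M * (t + 1) + 1) + 1 := by
    have h2 := Nat.lt_succ_of_le (key t)
    rw [Nat.div_lt_iff_lt_mul (by positivity)] at h2
    rw [div_pow, div_lt_iff₀ (by positivity)]
    exact_mod_cast h2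
  rw [pow_one, ← mul_div_assoc, div_lt_one (by positivity)] at ht
  have ht1' : (1 : ℝ) ≤ t := by exact_mod_cast ht1
  push_cast at ht
  have hA0 : (0 : ℝ) ≤ A := by positivity
  have hAM : (0 : ℝ) ≤ A * M := by positivity
  nlinarith

/-- In a hyperbolic group `g * c ^ m * g⁻¹ = c ^ (-n)` forces
`m = n`. -/
theorem eq_of_conj_pow_eq_inv (hℓ : IsHyperbolicLength ℓ δ) {c g : G} (hc : ¬IsOfFinOrder c)
    {m n : ℕ} (hm : 0 < m) (hn : 0 < n) (h : g * c ^ m * g⁻¹ = (c⁻¹) ^ n) : m = n := by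
  have h1 : ∀ q : ℕ, g * c ^ (m * q) * g⁻¹ = (c ^ (n * q))⁻¹ := fun q => by
    rw [pow_mul, ← conj_pow, h, ← pow_mul, inv_pow]
  have h2 : ∀ q : ℕ, c ^ (m * q) = g⁻¹ * (c ^ (n * q))⁻¹ * g⁻¹⁻¹ := fun q => by
    rw [← h1 q]; group
  refine le_antisymm (not_lt.1 (hℓ.not_lt_of_conj (g := g⁻¹) hc hn fun q => ?_))
    (not_lt.1 (hℓ.not_lt_of_conj (g := g) hc hm fun q => ?_))
  · rw [h2 q, ← hℓ.map_inv]
    congr 1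
    group
  · rw [h1 q, hℓ.map_inv]

end IsHyperbolicLength

/-! ### Elements inverting an element of infinite order -/

section Flip

theorem IsOfFinOrder.eq_one_of_int {x : Multiplicative ℤ} (hx : IsOfFinOrder x) : x = 1 := by
  obtain ⟨n, hn, hxn⟩ := isOfFinOrder_iff_pow_eq_one.1 hx
  exact (pow_eq_one_iff_left hn.ne').1 hxn

variable {G : Type*} [Group G]

/-- If `g` has finite order and inverts an element `d` of infinite order, then `d` and `g`
generate an infinite virtually cyclic group which is not of type I. -/
theorem exists_not_isTypeI_of_conj_eq_inv {d g : G} (hd : ¬IsOfFinOrder d) (hg : IsOfFinOrder g)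
    (h : g * d * g⁻¹ = d⁻¹) :
    ∃ V : Subgroup G, Infinite V ∧ IsVirtuallyCyclic V ∧ ¬IsTypeI V := by
  have hle : Subgroup.zpowers g ≤ Subgroup.normalizer (Subgroup.zpowers d : Set G) := by
    rw [Subgroup.zpowers_le, Subgroup.mem_normalizer_iff]
    have h' : ∀ k : ℤ, g * d ^ k * g⁻¹ = d ^ (-k) := fun k => by
      rw [← conj_zpow, h, inv_zpow']
    intro x
    constructor
    · rintro ⟨k, rfl⟩
      exact ⟨-k, (h' k).symm⟩
    · rintro ⟨k, hk⟩
      refine ⟨-k, ?_⟩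
      have h2 : g * d ^ (-k) * g⁻¹ = g * x * g⁻¹ := by rw [h', neg_neg]; exact hk
      simpa using h2
  set V := Subgroup.zpowers d ⊔ Subgroup.zpowers g with hV
  have hdV : d ∈ V := Subgroup.mem_sup_left (Subgroup.mem_zpowers d)
  have hgV : g ∈ V := Subgroup.mem_sup_right (Subgroup.mem_zpowers g)
  have hdV' : ¬IsOfFinOrder (⟨d, hdV⟩ : V) := fun h1 =>
    hd (by simpa using V.subtype.isOfFinOrder h1)
  refine ⟨V, Infinite.of_injective _ (injective_zpow_iff_not_isOfFinOrder.2 hdV'),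
    ⟨Subgroup.zpowers ⟨d, hdV⟩, inferInstance, ?_⟩, ?_⟩
  · have : Finite (Subgroup.zpowers g) := by
      exact (finite_zpowers.2 hg).to_subtype
    have hfin : Finite (V ⧸ Subgroup.zpowers (⟨d, hdV⟩ : V)) := by
      refine Finite.of_surjective
        (fun x : Subgroup.zpowers g =>
          ((⟨x, Subgroup.mem_sup_right x.2⟩ : V) : V ⧸ Subgroup.zpowers (⟨d, hdV⟩ : V))) ?_
      rintro ⟨⟨v, hv⟩⟩
      have hv' : v ∈ Subgroup.zpowers g ⊔ Subgroup.zpowers d := by rwa [sup_comm]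
      rw [← SetLike.mem_coe, Subgroup.coe_mul_of_left_le_normalizer_right _ _ hle] at hv'
      obtain ⟨a, ha, b, ⟨k, hb⟩, rfl⟩ := hv'
      refine ⟨⟨a, ha⟩, QuotientGroup.eq.2 ⟨k, ?_⟩⟩
      ext
      simpa using hb
    exact Subgroup.finiteIndex_of_finite_quotient
  · rintro ⟨-, p, hp⟩
    have hpg : p ⟨g, hgV⟩ = 1 := IsOfFinOrder.eq_one_of_int (p.isOfFinOrder (by
      rw [← Submonoid.isOfFinOrder_coe]; exact hg))
    have hpd : p ⟨d, hdV⟩ = 1 := by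
      have h1 : (⟨g, hgV⟩ : V) * ⟨d, hdV⟩ * ⟨g, hgV⟩⁻¹ = ⟨d, hdV⟩⁻¹ := Subtype.ext h
      have h2 := congrArg p h1
      rw [map_mul, map_mul, hpg, map_inv, hpg, map_inv] at h2
      refine IsOfFinOrder.eq_one_of_int (isOfFinOrder_iff_pow_eq_one.2 ⟨2, two_pos, ?_⟩)
      rw [pow_two]
      nth_rewrite 1 [show p ⟨d, hdV⟩ = (p ⟨d, hdV⟩)⁻¹ by simpa using h2]
      exact inv_mul_cancel _
    have hle : V ≤ p.ker.map V.subtype :=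
      sup_le (Subgroup.zpowers_le.2 ⟨_, hpd, rfl⟩) (Subgroup.zpowers_le.2 ⟨_, hpg, rfl⟩)
    obtain ⟨v, hv⟩ := hp (Multiplicative.ofAdd 1)
    obtain ⟨v', hv', hvv⟩ := hle v.2
    rw [← Subtype.ext hvv, (MonoidHom.mem_ker.1 hv')] at hv
    exact absurd hv (by decide)

/-- In a hyperbolic group all of whose infinite virtually cyclic subgroups are of type I, no
positive power of an element of infinite order is conjugate to a negative one. -/
theorem IsHyperbolicGroup.conj_pow_ne_inv (hG : IsHyperbolicGroup G)
    (hI : ∀ V : Subgroup G, Infinite V → IsVirtuallyCyclic V → IsTypeI V) {c : G}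
    (hc : ¬IsOfFinOrder c) (g : G) {m n : ℕ} (hm : 0 < m) (hn : 0 < n) :
    g * c ^ m * g⁻¹ ≠ (c⁻¹) ^ n := by
  intro h
  obtain ⟨ℓ, δ, hℓ⟩ := hG.exists_isHyperbolicLength
  obtain rfl := hℓ.eq_of_conj_pow_eq_inv hc hm hn h
  have hd : ¬IsOfFinOrder (c ^ m) := fun h1 => hc (h1.of_pow hm.ne')
  set d := c ^ m
  rw [inv_pow] at h
  have hinj := injective_zpow_iff_not_isOfFinOrder.2 hd
  have hconj : ∀ k : ℤ, g * d ^ k * g⁻¹ = d ^ (-k) := fun k => by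
    rw [← conj_zpow, h, inv_zpow']
  have hcomm : Commute (g ^ 2) d := by
    have h1 : g * d = d⁻¹ * g := by rw [← h, inv_mul_cancel_right]
    have h2 : g * d⁻¹ = d * g := by
      have := hconj (-1)
      rw [neg_neg, zpow_neg_one, zpow_one] at this
      nth_rewrite 2 [← this]
      rw [inv_mul_cancel_right]
    rw [commute_iff_eq, pow_two, mul_assoc, h1, ← mul_assoc, h2, mul_assoc]
  obtain ⟨j, k, j', k', hne, heq⟩ := hℓ.exists_pow_mul_pow_eq_of_commute hd hcomm
  have heq' : (g ^ 2) ^ ((j : ℤ) - j') = d ^ ((k' : ℤ) - k) := by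
    have hz : (g ^ 2) ^ (j : ℤ) * d ^ (k : ℤ) = (g ^ 2) ^ (j' : ℤ) * d ^ (k' : ℤ) := by
      exact_mod_cast heq
    rw [sub_eq_neg_add, zpow_add, eq_mul_inv_of_mul_eq hz, zpow_sub, zpow_neg]
    group
  -- Conjugation by `g` fixes the power of `g ^ 2` and inverts the power of `d` equal to it.
  have hk : (k' : ℤ) - k = 0 := by
    have h1 := hconj ((k' : ℤ) - k)
    rw [← heq'] at h1
    have h2 : g * (g ^ 2) ^ ((j : ℤ) - j') * g⁻¹ = (g ^ 2) ^ ((j : ℤ) - j') := by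
      have : Commute g ((g ^ 2) ^ ((j : ℤ) - j')) :=
        ((Commute.refl g).pow_right 2).zpow_right _
      rw [this.eq, mul_inv_cancel_right]
    rw [h2, heq'] at h1
    have := hinj h1
    omega
  have hj : (j : ℤ) - j' ≠ 0 := fun h1 => hne (by
    have : j = j' := by omega
    have : k = k' := by omega
    simp [*])
  have hgfin : IsOfFinOrder g := by
    rw [hk, zpow_zero] at heq'
    have : IsOfFinOrder (g ^ 2) := isOfFinOrder_iff_zpow_eq_one.2 ⟨_, hj, heq'⟩
    exact this.of_pow two_ne_zero
  obtain ⟨V, h1, h2, h3⟩ := exists_not_isTypeI_of_conj_eq_inv hd hgfin h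
  exact h3 (hI V h1 h2)

end Flip

/-! ### Structure of virtually cyclic groups -/

section TypeI

variable {V : Type*} [Group V]

theorem maxFiniteNormal_le_ker (p : V →* Multiplicative ℤ) : maxFiniteNormal V ≤ p.ker := by
  refine sSup_le fun N hN x hx => ?_
  have := hN.2
  exact IsOfFinOrder.eq_one_of_int
    (p.isOfFinOrder (N.subtype.isOfFinOrder (isOfFinOrder_of_finite (⟨x, hx⟩ : N))))

theorem IsVirtuallyCyclic.isTypeI_of_ne_one (hV : IsVirtuallyCyclic V)
    (p : V →* Multiplicative ℤ) {x : V} (hx : p x ≠ 1) : IsTypeI V := by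
  have hinf : Infinite p.range := by
    refine Infinite.of_injective (fun k : ℤ => (⟨p (x ^ k), x ^ k, rfl⟩ : p.range)) ?_
    intro k l hkl
    have h1 : p x ^ k = p x ^ l := by simpa using congrArg Subtype.val hkl
    exact injective_zpow_iff_not_isOfFinOrder.2 (fun h => hx h.eq_one_of_int) h1
  let e : Multiplicative ℤ ≃* p.range := intCyclicMulEquiv
  exact ⟨hV, e.symm.toMonoidHom.comp p.rangeRestrict,
    e.symm.surjective.comp p.rangeRestrict_surjective⟩

/-- The normal core of a cyclic subgroup of finite index is again cyclic of finite index. -/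
theorem IsVirtuallyCyclic.exists_normal_zpowers (hV : IsVirtuallyCyclic V) [Infinite V] :
    ∃ d : V, ¬IsOfFinOrder d ∧ (Subgroup.zpowers d).Normal ∧
      (Subgroup.zpowers d).FiniteIndex := by
  obtain ⟨C, hC, hfi⟩ := hV
  have hcyc : IsCyclic C.normalCore :=
    isCyclic_of_injective _ (Subgroup.inclusion_injective C.normalCore_le)
  obtain ⟨d, hd⟩ := (Subgroup.isCyclic_iff_exists_zpowers_eq_top _).1 hcyc
  refine ⟨d, fun h => ?_, by rw [hd]; infer_instance, by rw [hd]; infer_instance⟩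
  have h1 : Finite (Subgroup.zpowers d) := (finite_zpowers.2 h).to_subtype
  have h2 : (Subgroup.zpowers d).FiniteIndex := by rw [hd]; infer_instance
  have h3 : Finite (V ⧸ Subgroup.zpowers d) := inferInstance
  have : Finite V := Finite.of_equiv _
    (Subgroup.groupEquivQuotientProdSubgroup (s := Subgroup.zpowers d)).symm
  exact not_finite V

theorem conj_eq_or_eq_inv_of_normal_zpowers {d : V} (hd : ¬IsOfFinOrder d)
    (hn : (Subgroup.zpowers d).Normal) (v : V) : v * d * v⁻¹ = d ∨ v * d * v⁻¹ = d⁻¹ := by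
  obtain ⟨k, hk⟩ := hn.conj_mem d (Subgroup.mem_zpowers d) v
  obtain ⟨l, hl⟩ := hn.conj_mem d (Subgroup.mem_zpowers d) v⁻¹
  simp only at hk hl
  have h1 : d ^ (k * l) = d ^ (1 : ℤ) := by
    rw [mul_comm, zpow_mul, hl, conj_zpow, hk]
    group
  have h2 : k * l = 1 := injective_zpow_iff_not_isOfFinOrder.2 hd h1
  rcases Int.eq_one_or_neg_one_of_mul_eq_one h2 with rfl | rfl
  · left; rw [← hk, zpow_one]
  · right; rw [← hk, zpow_neg_one]

/-- An infinite virtually cyclic group which is not of type I contains an element inverting an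
element of infinite order. -/
theorem IsVirtuallyCyclic.exists_conj_eq_inv (hV : IsVirtuallyCyclic V) [Infinite V]
    (hI : ¬IsTypeI V) : ∃ d v : V, ¬IsOfFinOrder d ∧ v * d * v⁻¹ = d⁻¹ := by
  obtain ⟨d, hd, hn, hfi⟩ := hV.exists_normal_zpowers
  by_contra! hne
  have hcomm : ∀ v : V, Commute v d := fun v =>
    mul_inv_eq_iff_eq_mul.1 ((conj_eq_or_eq_inv_of_normal_zpowers hd hn v).resolve_right
      (hne d v hd))
  have hinf : Infinite (Subgroup.zpowers d) :=
    (Set.infinite_coe_iff.2 (infinite_zpowers.2 hd))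
  let e : Multiplicative ℤ ≃* Subgroup.zpowers d := intCyclicMulEquiv
  -- If nothing inverts `d`, its cyclic group is central, and the transfer to it sends `d` to `d ^
  -- index`, which is nontrivial.
  refine hI (hV.isTypeI_of_ne_one (MonoidHom.transfer e.symm.toMonoidHom) (x := d) ?_)
  rw [MonoidHom.transfer_eq_pow _ _ fun k g _ => by
    rw [mul_assoc, ((hcomm g).pow_right k).symm.eq, inv_mul_cancel_left]]
  intro h
  have h1 := (MulEquiv.map_eq_one_iff e.symm).1 h
  have h2 : d ^ (Subgroup.zpowers d).index = 1 := congrArg Subtype.val h1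
  exact hd (isOfFinOrder_iff_pow_eq_one.2 ⟨_, Nat.pos_of_ne_zero hfi.index_ne_zero, h2⟩)

theorem isTypeI_zpowers {d : V} (hd : ¬IsOfFinOrder d) : IsTypeI (Subgroup.zpowers d) := by
  have hinf : Infinite (Subgroup.zpowers d) :=
    (Set.infinite_coe_iff.2 (infinite_zpowers.2 hd))
  let e : Multiplicative ℤ ≃* Subgroup.zpowers d := intCyclicMulEquiv
  exact ⟨⟨⊤, Subgroup.topEquiv.isCyclic.2 inferInstance, inferInstance⟩, e.symm.toMonoidHom,
    e.symm.surjective⟩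

/-- A generator of `Q_V` has infinite order. -/
theorem IsTypeI.not_isOfFinOrder_of_zpowers_eq_top (hV : IsTypeI V) {σ : QuotMaxFiniteNormal V}
    (hσ : Subgroup.zpowers σ = ⊤) : ¬IsOfFinOrder σ := by
  obtain ⟨-, p, hp⟩ := hV
  intro h
  let q : QuotMaxFiniteNormal V →* Multiplicative ℤ :=
    QuotientGroup.lift _ p (maxFiniteNormal_le_ker p)
  have h1 : q σ = 1 := (q.isOfFinOrder h).eq_one_of_int
  obtain ⟨v, hv⟩ := hp (Multiplicative.ofAdd 1)
  obtain ⟨k, hk⟩ : (v : QuotMaxFiniteNormal V) ∈ Subgroup.zpowers σ := hσ ▸ Subgroup.mem_top _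
  have h2 : q v = 1 := by
    rw [← hk]
    simp [h1]
  have h3 : q v = p v := rfl
  rw [← h3, h2] at hv
  exact absurd hv (by decide)

/-- A type I group has an element mapping to a generator of `Q_V`. -/
theorem IsTypeI.exists_zpowers_eq_top (hV : IsTypeI V) :
    ∃ u : V, Subgroup.zpowers (u : QuotMaxFiniteNormal V) = ⊤ := by
  obtain ⟨hvc, p, hp⟩ := hV
  obtain ⟨u, hu⟩ := hp (Multiplicative.ofAdd 1)
  refine ⟨u, (Subgroup.eq_top_iff' _).2 ?_⟩
  rintro ⟨v⟩
  refine ⟨Multiplicative.toAdd (p v), ?_⟩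
  refine (QuotientGroup.eq (a := u ^ (Multiplicative.toAdd (p v)))).2 ?_
  refine le_maxFiniteNormal (N := p.ker) inferInstance (hvc.finite_ker p hp) ?_
  rw [MonoidHom.mem_ker, map_mul, map_inv, map_zpow, hu, ← ofAdd_zsmul]
  simp

theorem IsTypeI.finite_maxFiniteNormal (hV : IsTypeI V) : Finite (maxFiniteNormal V) := by
  obtain ⟨hvc, p, hp⟩ := hV
  have := hvc.finite_ker p hp
  exact Finite.of_injective _ (Subgroup.inclusion_injective (maxFiniteNormal_le_ker p))

/-- Elements with the same image modulo a finite normal subgroup have a common power. -/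
theorem exists_pow_eq_of_quotient_eq {N : Subgroup V} [N.Normal] [Finite N] {x y : V}
    (h : (x : V ⧸ N) = y) : ∃ m : ℕ, 0 < m ∧ x ^ m = y ^ m := by
  have hmem : ∀ i : ℕ, x ^ i * (y ^ i)⁻¹ ∈ N := fun i => by
    rw [← QuotientGroup.eq_one_iff]
    simp [h]
  -- Pigeonhole on `x ^ i * y ^ (-i)`; equal values at `i < j` give `x ^ (j - i) = y ^ (j - i)`.
  obtain ⟨i, j, hij, heq⟩ := Finite.exists_ne_map_eq_of_infinite
    fun i : ℕ => (⟨_, hmem i⟩ : N)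
  have heq' : x ^ i * (y ^ i)⁻¹ = x ^ j * (y ^ j)⁻¹ := congrArg Subtype.val heq
  wlog hlt : i < j generalizing i j
  · exact this j i hij.symm heq.symm heq'.symm (by omega)
  obtain ⟨m, rfl⟩ := Nat.exists_eq_add_of_lt hlt
  refine ⟨m + 1, by omega, ?_⟩
  rw [add_assoc, pow_add x, pow_add y] at heq'
  rw [mul_inv_rev, mul_assoc, mul_right_inj, ← mul_assoc] at heq'
  have := mul_right_cancel ((one_mul _).trans heq')
  exact (mul_inv_eq_one.1 this.symm)

end TypeI

/-! ### Orientations and commensurability classes -/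

section Orientation

variable {G : Type*} [Group G]

theorem TypeISubgroupsOrientable.isTypeI (h : TypeISubgroupsOrientable G) (V : Subgroup G)
    [Infinite V] (hV : IsVirtuallyCyclic V) : IsTypeI V := by
  by_contra hI
  obtain ⟨σ, hgen, hσ⟩ := h
  obtain ⟨⟨d, hdV⟩, ⟨v, hvV⟩, hd', hdv'⟩ := hV.exists_conj_eq_inv hI
  have hd : ¬IsOfFinOrder d := fun h => hd' (by
    rw [← Submonoid.isOfFinOrder_coe]; exact h)
  have hdv : v * d * v⁻¹ = d⁻¹ := congrArg Subtype.val hdv'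
  have hinv : ∀ x ∈ Subgroup.zpowers d, v * x * v⁻¹ = x⁻¹ := by
    rintro _ ⟨k, rfl⟩
    simp only
    rw [← conj_zpow, hdv, inv_zpow]
  let f : Subgroup.zpowers d →* Subgroup.zpowers d :=
    MonoidHom.mk' (fun x => ⟨v * x * v⁻¹, by rw [hinv x x.2]; exact inv_mem x.2⟩)
      fun x y => Subtype.ext (by simp)
  let D : {V : Subgroup G // IsTypeI V} := ⟨Subgroup.zpowers d, isTypeI_zpowers hd⟩
  obtain ⟨n, -, hn⟩ := hσ D D f (Or.inr ⟨v, fun _ => rfl⟩)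
  have hmap : ∀ x, quotMaxFiniteNormalMap D.2 f x = x⁻¹ := by
    rintro ⟨x⟩
    exact congrArg (QuotientGroup.mk (s := maxFiniteNormal D.1)) (Subtype.ext (hinv x x.2))
  refine D.2.not_isOfFinOrder_of_zpowers_eq_top (hgen D)
    (isOfFinOrder_iff_pow_eq_one.2 ⟨n + 1, n.succ_pos, ?_⟩)
  rw [pow_succ, ← hn, hmap, inv_mul_cancel]

/-- Two elements are commensurable if positive powers of them are conjugate. -/
def powConjSetoid (G : Type*) [Group G] : Setoid G where
  r x y := ∃ (g : G) (m n : ℕ), 0 < m ∧ 0 < n ∧ g * x ^ m * g⁻¹ = y ^ n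
  iseqv :=
    { refl := fun x => ⟨1, 1, 1, one_pos, one_pos, by simp⟩
      symm := by
        rintro x y ⟨g, m, n, hm, hn, h⟩
        exact ⟨g⁻¹, n, m, hn, hm, by rw [← h]; group⟩
      trans := by
        rintro x y z ⟨g, m, n, hm, hn, h⟩ ⟨g', m', n', hm', hn', h'⟩
        refine ⟨g' * g, m * m', n' * n, Nat.mul_pos hm hm', Nat.mul_pos hn' hn, ?_⟩
        rw [pow_mul z, ← h', conj_pow, ← pow_mul, mul_comm m' n, pow_mul y, ← h, conj_pow,
          ← pow_mul]
        group }

theorem powConjSetoid_inv {x y : G} (h : powConjSetoid G x y) : powConjSetoid G x⁻¹ y⁻¹ := by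
  obtain ⟨g, m, n, hm, hn, h⟩ := h
  exact ⟨g, m, n, hm, hn, by rw [inv_pow, inv_pow, ← h]; group⟩

/-- If no element of infinite order is commensurable to its inverse, one can consistently choose
one of `x` and `x⁻¹` for all `x` of infinite order. -/
theorem exists_positive (h : ∀ x : G, ¬IsOfFinOrder x → ¬powConjSetoid G x x⁻¹) :
    ∃ P : G → Prop, (∀ x y, powConjSetoid G x y → P x → P y) ∧ (∀ x, P x ∨ P x⁻¹) ∧
      ∀ x, ¬IsOfFinOrder x → P x → ¬P x⁻¹ := by
  let s := powConjSetoid G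
  -- `t` merges each class with its inverse class; positive elements are those `s`-related to the
  -- chosen representative of their `t`-class.
  let t : Setoid G :=
    { r := fun x y => s x y ∨ s x y⁻¹
      iseqv :=
        { refl := fun x => Or.inl (s.refl x)
          symm := by
            rintro x y (h | h)
            · exact Or.inl (s.symm h)
            · exact Or.inr (by simpa using powConjSetoid_inv (s.symm h))
          trans := by
            rintro x y z (h | h) (h' | h')
            · exact Or.inl (s.trans h h')
            · exact Or.inr (s.trans h h')
            · exact Or.inr (s.trans h (powConjSetoid_inv h'))
            · exact Or.inl (s.trans h (by simpa using powConjSetoid_inv h')) } }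
  let rep : G → G := fun x => (Quotient.mk t x).out
  have hrep : ∀ x, t x (rep x) := fun x => t.symm (Quotient.mk_out (s := t) x)
  have hrep_eq : ∀ x y, t x y → rep x = rep y := fun x y hxy =>
    congrArg Quotient.out (Quotient.sound (s := t) hxy)
  have hrep_inv : ∀ x, rep x⁻¹ = rep x := fun x => hrep_eq _ _ (Or.inr (s.refl _))
  refine ⟨fun x => s x (rep x), fun x y hxy hx => ?_, fun x => ?_, fun x hx h1 h2 => ?_⟩
  · change s y (rep y)
    rw [← hrep_eq x y (Or.inl hxy)]
    exact s.trans (s.symm hxy) hx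
  · refine (hrep x).imp id fun h1 => ?_
    change s x⁻¹ (rep x⁻¹)
    rw [hrep_inv]
    simpa using powConjSetoid_inv h1
  · change s x⁻¹ (rep x⁻¹) at h2
    rw [hrep_inv] at h2
    exact h x hx (s.trans h1 (s.symm h2))

/-- Orient each `V` by a generator of `Q_V` with a positive lift `u V`. If `f` sends it to the
`k`-th power of the generator for `W`, a common power lifts this relation to `G`: `k < 0` would make
`(u W)⁻¹` positive too, and `k = 0` would make `u V` torsion. -/
theorem typeISubgroupsOrientable_of_not_powConj
    (h : ∀ x : G, ¬IsOfFinOrder x → ¬powConjSetoid G x x⁻¹) : TypeISubgroupsOrientable G := by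
  obtain ⟨P, hP, hP_or, hP_not⟩ := exists_positive h
  have hex : ∀ V : {V : Subgroup G // IsTypeI V}, ∃ u : V.1, P u ∧
      Subgroup.zpowers (u : QuotMaxFiniteNormal V.1) = ⊤ := fun V => by
    obtain ⟨u, hu⟩ := V.2.exists_zpowers_eq_top
    rcases hP_or u with h1 | h1
    · exact ⟨u, h1, hu⟩
    · refine ⟨u⁻¹, h1, ?_⟩
      rw [QuotientGroup.mk_inv, Subgroup.zpowers_inv, hu]
  choose u hu hgen using hex
  have hord : ∀ V, ¬IsOfFinOrder (u V : G) := fun V h1 =>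
    V.2.not_isOfFinOrder_of_zpowers_eq_top (hgen V)
      ((QuotientGroup.mk' (maxFiniteNormal V.1)).isOfFinOrder (x := u V) (by
        rw [← Submonoid.isOfFinOrder_coe]; exact h1))
  refine ⟨fun V => (u V : QuotMaxFiniteNormal V.1), hgen, fun V W f hf => ?_⟩
  obtain ⟨g, hg⟩ : ∃ g : G, ∀ v : V.1, (f v : G) = g * v * g⁻¹ := by
    rcases hf with hf | hf
    · exact ⟨1, fun v => by simp [hf]⟩
    · exact hf
  obtain ⟨k, hk⟩ : ((f (u V) : W.1) : QuotMaxFiniteNormal W.1) ∈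
    Subgroup.zpowers (u W : QuotMaxFiniteNormal W.1) := hgen W ▸ Subgroup.mem_top _
  have := W.2.finite_maxFiniteNormal
  obtain ⟨m, hm, hpow⟩ := exists_pow_eq_of_quotient_eq (N := maxFiniteNormal W.1)
    (x := f (u V)) (y := u W ^ k) hk.symm
  have hpow' : g * (u V : G) ^ m * g⁻¹ = (u W : G) ^ (k * m) := by
    rw [← conj_pow, ← hg, zpow_mul, zpow_natCast]
    exact congrArg Subtype.val hpow
  suffices hk0 : 0 < k by
    refine ⟨k.toNat, by omega, ?_⟩
    rw [← zpow_natCast, Int.toNat_of_nonneg hk0.le]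
    exact hk.symm
  by_contra hk0
  rcases (not_lt.1 hk0).lt_or_eq with hneg | rfl
  · refine hP_not _ (hord W) (hu W) (hP _ _ ⟨g, m, (-k).toNat * m, hm, ?_, ?_⟩ (hu V))
    · exact Nat.mul_pos (by omega) hm
    · rw [hpow', ← zpow_natCast, Nat.cast_mul, Int.toNat_of_nonneg (by omega), inv_zpow']
      congr 1
      ring
  · rw [zero_mul, zpow_zero, conj_eq_one_iff] at hpow'
    exact hord V (isOfFinOrder_iff_pow_eq_one.2 ⟨m, hm, hpow'⟩)

end Orientation

theorem mainTheorem5 {G : Type*} [Group G] (hG : IsHyperbolicGroup G) :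
    TypeISubgroupsOrientable G ↔
      ∀ V : Subgroup G, Infinite V → IsVirtuallyCyclic V → IsTypeI V := by
  refine ⟨fun h V _ hV => h.isTypeI V hV, fun h => typeISubgroupsOrientable_of_not_powConj ?_⟩
  rintro x hx ⟨g, m, n, hm, hn, heq⟩
  exact hG.conj_pow_ne_inv h hx g hm hn heq
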